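/- Let $(X,d)$ be a compact metric space with Borel $\sigma$-algebra $\mathscr B(X)$, and let $T$ be a correspondence on $X$, i.e. an upper semicontinuous map from $X$ to the nonempty closed subsets of $X$. For $n\ge 1$ let $\mathcal O_{n}(T)=\{(x_1,\dots,x_n)\in X^n: x_{i+1}\in T(x_i),\ 1\le i<n\}$ with the metric $d_n(x,y)=\max_i d(x_i,y_i)$. For $\phi\in C(\mathcal O_2(T))$ (real-valued continuous functions) put $S_n\phi(x_1,\dots,x_{n+1})=\sum_{i=1}^n\phi(x_i,x_{i+1})$ and let $$P(T,\phi)=\lim_{\epsilon\to0^+}\limsup_{n\to\infty}\frac1n\log\sup_{E}\sum_{x\in E}e^{S_n\phi(x)}\in[-\infty,+\infty],$$ where $E$ ranges over the subsets of $\mathcal O_{n+1}(T)$ any two distinct points of which have distance at least $\epsilon$. The topological entropy of $T$ is $P(T,0)$. A transition probability kernel $\mathcal Q$ on $X$ is supported by $T$ if $\mathcal Q_x(T(x))=1$ for every $x\in X$; a Borel probability measure $\mu$ is $\mathcal Q$-invariant if $\mu\mathcal Q=\mu$. Let $\mathcal Q^{[0]}_x=\delta_x$ and let $\mathcal Q^{[n]}_x(A)=\int\mathcal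 Q\bigl(x_n,\{y:(x_1,\dots,x_n,y)\in A\}\bigr)\,d\mathcal Q^{[n-1]}_x(x_1,\dots,x_n)$ be the induced kernels from $X$ to $X^{n+1}$. For $\mathcal Q$-invariant $\mu$ let $$h_\mu(\mathcal Q)=\sup_{\mathcal A}\lim_{n\to\infty}\frac1n H_{\mu\mathcal Q^{[n-1]}}(\mathcal A^n),$$ where $\mathcal A$ ranges over the finite measurable partitions of $X$, $\mathcal A^n$ is the product partition of $X^n$ and $H_m(\mathcal B)=-\sum_{B\in\mathcal B}m(B)\log m(B)$. For $\mathcal Q$ supported by $T$ and any Borel probability measure $\mu$ on $X$ let $$\mathfrak h_\mu(\mathcal Q)=\inf\Bigl\{\int_X\int_{T(x)}\psi(x,y)\,d\mathcal Q_x(y)\,d\mu(x):\ \psi\in C(\mathcal O_2(T)),\ P(T,-\psi)\le0\Bigr\}.$$ Consider pairs $(\mathcal Q,\mu)$ of a transition probability kernel $\mathcal Q$ on $X$ supported by $T$ and a Borel probability measure $\mu$ on $X$, and let $\phi\in C(\mathcal O_2(T))$. Such a pair is * a type I equilibrium state for $\phi$ if $\mu$ is $\mathcal Q$-invariant and $P(T,\phi)=h_\mu(\mathcal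 Q)+\int_X\int_{T(x)}\phi(x,y)\,d\mathcal Q_x(y)\,d\mu(x)$; * a type II equilibrium state for $\phi$ if $P(T,\phi)=\mathfrak h_\mu(\mathcal Q)+\int_X\int_{T(x)}\phi(x,y)\,d\mathcal Q_x(y)\,d\mu(x)$; * a tangent functional to $P(T,\cdot)$ at $\phi$ if $P(T,\phi+\psi)-P(T,\phi)\ge\int_{\mathcal O_2(T)}\psi\,d(\mu\mathcal Q^{[1]})$ for all $\psi\in C(\mathcal O_2(T))$. Denote the sets of these pairs by $e^1_\phi(X,T)$, $e^2_\phi(X,T)$ and $t_\phi(X,T)$. **Theorem.** Suppose that $T$ has finite topological entropy, $P(T,0)<+\infty$. Then for every $\phi\in C(\mathcal O_2(T))$: 1. $e^1_\phi(X,T)\subset t_\phi(X,T)$; 2. $e^2_\phi(X,T)=t_\phi(X,T)$. -/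

import Mathlib

open Filter Topology MeasureTheory ProbabilityTheory

/-- A correspondence on `X`: an upper semicontinuous map from `X` to the nonempty closed subsets
of `X`. -/
structure Correspondence (X : Type*) [TopologicalSpace X] where
  toFun : X → Set X
  nonempty' : ∀ x, (toFun x).Nonempty
  isClosed' : ∀ x, IsClosed (toFun x)
  upperHemicontinuous' : UpperHemicontinuous toFun

namespace Correspondence

instance {X : Type*} [TopologicalSpace X] : CoeFun (Correspondence X) (fun _ => X → Set X) :=
  ⟨Correspondence.toFun⟩

/-- The set `𝒪_n(T)` of orbits `(x_1, …, x_n)` (indexed from `0`), with `x_{i+1} ∈ T(x_i)`. As a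
subset of `Fin n → X` it carries the metric `max_i d(x_i, y_i)`. -/
def orbits {X : Type*} [TopologicalSpace X] (T : Correspondence X) (n : ℕ) : Set (Fin n → X) :=
  {x | ∀ (i : ℕ) (h : i + 1 < n), x ⟨i + 1, h⟩ ∈ T (x ⟨i, Nat.lt_of_succ_lt h⟩)}

/-- The element `(x, y)` of `𝒪_2(T)`, for `y ∈ T(x)`. -/
def pair {X : Type*} [TopologicalSpace X] (T : Correspondence X) (x : X) (y : T x) :
    T.orbits 2 :=
  ⟨![x, (y : X)], by
    intro i h
    obtain rfl : i = 0 := by omega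
    exact y.2⟩

theorem isClosed_orbits {X : Type*} [MetricSpace X] (T : Correspondence X) (n : ℕ) :
    IsClosed (T.orbits n) := by
  refine IsSeqClosed.isClosed ?_
  intro u a hu ha i h
  have h0 := (continuous_apply (⟨i, Nat.lt_of_succ_lt h⟩ : Fin n)).continuousAt.tendsto.comp ha
  have h1 := (continuous_apply (⟨i + 1, h⟩ : Fin n)).continuousAt.tendsto.comp ha
  exact UpperHemicontinuousAt.mem_of_tendsto (T.upperHemicontinuous' _) (T.isClosed' _) h0
    (Eventually.of_forall fun k => hu k i h).frequently h1

/-- The Birkhoff sum `S_n φ (x_1, …, x_{n+1}) = ∑_{i=1}^n φ(x_i, x_{i+1})` on `𝒪_{n+1}(T)`. -/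
noncomputable def birkhoffSum {X : Type*} [TopologicalSpace X] (T : Correspondence X)
    (φ : C(T.orbits 2, ℝ)) (n : ℕ) (x : T.orbits (n + 1)) : ℝ :=
  ∑ i : Fin n, φ (T.pair (x.1 i.castSucc) ⟨x.1 i.succ, x.2 i.1 (Nat.succ_lt_succ i.2)⟩)

/-- `s_n(T, φ, ε)`: the supremum of `∑_{x ∈ E} exp (S_n φ x)` over the `ε`-separated subsets `E` of
`𝒪_{n+1}(T)`, where separated means that distinct points have distance at least `ε`. -/
noncomputable def sepSum {X : Type*} [MetricSpace X] (T : Correspondence X)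
    (φ : C(T.orbits 2, ℝ)) (n : ℕ) (ε : ℝ) : ENNReal :=
  ⨆ (E : Set (T.orbits (n + 1))) (_ : E.Pairwise fun x y => ε ≤ dist x y),
    ∑' x : E, ENNReal.ofReal (Real.exp (T.birkhoffSum φ n x))

/-- `limsup_n (1/n) log s_n(T, φ, ε)`. -/
noncomputable def pressureAt {X : Type*} [MetricSpace X] (T : Correspondence X)
    (φ : C(T.orbits 2, ℝ)) (ε : ℝ) : EReal :=
  limsup (fun n : ℕ => ENNReal.log (T.sepSum φ n ε) / (n : EReal)) atTop

/-- The topological pressure `P(T, φ) = lim_{ε → 0+} limsup_n (1/n) log s_n(T, φ, ε)`, with values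
in the extended reals. The quantity under the limit is antitone in `ε`, so the limit is the
supremum over `ε > 0`; see `tendsto_pressureAt`. -/
noncomputable def pressure {X : Type*} [MetricSpace X] (T : Correspondence X)
    (φ : C(T.orbits 2, ℝ)) : EReal :=
  ⨆ (ε : ℝ) (_ : 0 < ε), T.pressureAt φ ε

theorem pressureAt_antitone {X : Type*} [MetricSpace X] (T : Correspondence X)
    (φ : C(T.orbits 2, ℝ)) : Antitone (T.pressureAt φ) := by
  intro a b hab
  refine limsup_le_limsup (Eventually.of_forall fun n => ?_)
  refine EReal.div_le_div_right_of_nonneg (Nat.cast_nonneg' n) (ENNReal.log_monotone ?_)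
  refine iSup_mono fun E => iSup_le fun hE => ?_
  exact le_iSup_of_le (fun x hx y hy hxy => hab.trans (hE hx hy hxy)) le_rfl

theorem tendsto_pressureAt {X : Type*} [MetricSpace X] (T : Correspondence X)
    (φ : C(T.orbits 2, ℝ)) : Tendsto (T.pressureAt φ) (𝓝[>] 0) (𝓝 (T.pressure φ)) := by
  have h := (T.pressureAt_antitone φ).tendsto_nhdsGT 0
  rwa [sSup_image] at h

/-- The topological entropy `P(T, 0)`. -/
noncomputable def topEntropy {X : Type*} [MetricSpace X] (T : Correspondence X) : EReal :=
  T.pressure 0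

/-- The kernel `Q` is supported by `T`: `Q_x(T(x)) = 1` for every `x`. -/
def Supports {X : Type*} [TopologicalSpace X] [MeasurableSpace X] (T : Correspondence X)
    (Q : Kernel X X) : Prop :=
  ∀ x, Q x (T x) = 1

end Correspondence

/-- The kernel `Q^{[n]}` from `X` to `X^{n+1}`: `Q^{[0]}_x` is the Dirac measure at `x`, and
`Q^{[n+1]}_x` is the law obtained from `Q^{[n]}_x` by appending a point chosen according to
`Q_{x_{n+1}}`; see `kernelPath_succ_apply`. -/
noncomputable def kernelPath {X : Type*} [MeasurableSpace X] (Q : Kernel X X) :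
    (n : ℕ) → Kernel X (Fin (n + 1) → X)
  | 0 => Kernel.deterministic (fun x _ => x) (measurable_pi_lambda _ fun _ => measurable_id)
  | n + 1 =>
    ((kernelPath Q n).compProd
      (Q.comap (fun p : X × (Fin (n + 1) → X) => p.2 (Fin.last n))
        ((measurable_pi_apply _).comp measurable_snd))).map
      (fun p : (Fin (n + 1) → X) × X => (Fin.snoc p.1 p.2 : Fin (n + 2) → X))

theorem measurable_snoc {X : Type*} [MeasurableSpace X] (n : ℕ) :
    Measurable (fun p : (Fin n → X) × X => (Fin.snoc p.1 p.2 : Fin (n + 1) → X)) := by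
  refine measurable_pi_lambda _ fun i => ?_
  refine Fin.lastCases ?_ (fun j => ?_) i
  · simpa using measurable_snd
  · simpa [Function.comp_def] using
      (measurable_pi_apply j).comp (measurable_fst (α := Fin n → X) (β := X))

instance isMarkovKernel_kernelPath {X : Type*} [MeasurableSpace X] (Q : Kernel X X)
    [IsMarkovKernel Q] : (n : ℕ) → IsMarkovKernel (kernelPath Q n)
  | 0 => by unfold kernelPath; infer_instance
  | n + 1 => by
    have := isMarkovKernel_kernelPath Q n
    unfold kernelPath
    exact Kernel.IsMarkovKernel.map _ (measurable_snoc _)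

/-- `Q^{[n+1]}(x, A) = ∫ Q(x_{n+1}, {y | (x_1, …, x_{n+1}, y) ∈ A}) dQ^{[n]}_x(x_1, …, x_{n+1})`. -/
theorem kernelPath_succ_apply {X : Type*} [MeasurableSpace X] (Q : Kernel X X)
    [IsMarkovKernel Q] (n : ℕ) (x : X) {A : Set (Fin (n + 2) → X)} (hA : MeasurableSet A) :
    kernelPath Q (n + 1) x A =
      ∫⁻ p, Q (p (Fin.last n)) {y | (Fin.snoc p y : Fin (n + 2) → X) ∈ A} ∂(kernelPath Q n x) := by
  rw [kernelPath, Kernel.map_apply' _ (measurable_snoc _) _ hA,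
    Kernel.compProd_apply (measurable_snoc _ hA)]
  rfl

/-- A finite measurable partition `{A_1, …, A_k}` of `X`. -/
structure FinMeasurablePartition (X : Type*) [MeasurableSpace X] where
  card : ℕ
  cell : Fin card → Set X
  measurableSet_cell : ∀ i, MeasurableSet (cell i)
  disjoint_cell : Pairwise fun i j => Disjoint (cell i) (cell j)
  iUnion_cell : ⋃ i, cell i = Set.univ

/-- The entropy `H_m(𝒜^n) = -∑ m(A_{a_1} × ⋯ × A_{a_n}) log m(A_{a_1} × ⋯ × A_{a_n})` of the product
partition `𝒜^n` of `X^n` with respect to a probability measure `m` on `X^n`. -/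
noncomputable def FinMeasurablePartition.powEntropy {X : Type*} [MeasurableSpace X]
    (𝒜 : FinMeasurablePartition X) (n : ℕ) (m : Measure (Fin n → X)) : ℝ :=
  ∑ a : Fin n → Fin 𝒜.card, Real.negMulLog (m.real (Set.univ.pi fun i => 𝒜.cell (a i)))

/-- `h_μ(Q, 𝒜) = lim_n (1/n) H_{μ Q^{[n-1]}}(𝒜^n)`, written with `n + 1` for `n`. For a
`Q`-invariant probability measure `μ` the entropies are subadditive in `n`, so the limit exists
and is this upper limit. -/
noncomputable def kernelEntropyOf {X : Type*} [MeasurableSpace X] (Q : Kernel X X) (μ : Measure X)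
    (𝒜 : FinMeasurablePartition X) : EReal :=
  limsup (fun n : ℕ =>
    ((𝒜.powEntropy (n + 1) (μ.bind (kernelPath Q n)) / ((n : ℝ) + 1) : ℝ) : EReal)) atTop

/-- The measure-theoretic entropy `h_μ(Q) = sup_𝒜 h_μ(Q, 𝒜)`. -/
noncomputable def kernelEntropy {X : Type*} [MeasurableSpace X] (Q : Kernel X X)
    (μ : Measure X) : EReal :=
  ⨆ 𝒜 : FinMeasurablePartition X, kernelEntropyOf Q μ 𝒜

namespace Correspondence

/-- `∫_X ∫_{T(x)} φ(x, y) dQ_x(y) dμ(x)`. -/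
noncomputable def doubleIntegral {X : Type*} [TopologicalSpace X] [MeasurableSpace X]
    (T : Correspondence X) (φ : C(T.orbits 2, ℝ)) (Q : Kernel X X) (μ : Measure X) : ℝ :=
  ∫ x, ∫ y : T x, φ (T.pair x y) ∂((Q x).comap Subtype.val) ∂μ

/-- `∫_{𝒪_2(T)} φ d(μ Q^{[1]})`. -/
noncomputable def orbitIntegral {X : Type*} [TopologicalSpace X] [MeasurableSpace X]
    (T : Correspondence X) (φ : C(T.orbits 2, ℝ)) (Q : Kernel X X) (μ : Measure X) : ℝ :=
  ∫ p : T.orbits 2, φ p ∂((μ.bind (kernelPath Q 1)).comap Subtype.val)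

/-- The abstract entropy `𝔥_μ(Q)`: the infimum of `∫_X ∫_{T(x)} φ(x, y) dQ_x(y) dμ(x)` over the
continuous `φ` on `𝒪_2(T)` with `P(T, -φ) ≤ 0`. -/
noncomputable def abstractEntropy {X : Type*} [MetricSpace X] [MeasurableSpace X]
    (T : Correspondence X) (Q : Kernel X X) (μ : Measure X) : EReal :=
  ⨅ (φ : C(T.orbits 2, ℝ)) (_ : T.pressure (-φ) ≤ 0), (T.doubleIntegral φ Q μ : EReal)

/-- The pairs `(Q, μ)` of a transition probability kernel `Q` on `X` supported by `T` and a Borel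
probability measure `μ` on `X`. -/
def admissiblePairs {X : Type*} [TopologicalSpace X] [MeasurableSpace X] (T : Correspondence X) :
    Set (Kernel X X × Measure X) :=
  {p | IsMarkovKernel p.1 ∧ T.Supports p.1 ∧ IsProbabilityMeasure p.2}

/-- The set `e¹_φ(X, T)` of type I equilibrium states. -/
def typeIEquilibriumStates {X : Type*} [MetricSpace X] [MeasurableSpace X]
    (T : Correspondence X) (φ : C(T.orbits 2, ℝ)) : Set (Kernel X X × Measure X) :=
  {p | p ∈ T.admissiblePairs ∧ p.1.Invariant p.2 ∧
    T.pressure φ = kernelEntropy p.1 p.2 + (T.doubleIntegral φ p.1 p.2 : EReal)}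

/-- The set `e²_φ(X, T)` of type II equilibrium states; `μ` is not assumed `Q`-invariant. -/
def typeIIEquilibriumStates {X : Type*} [MetricSpace X] [MeasurableSpace X]
    (T : Correspondence X) (φ : C(T.orbits 2, ℝ)) : Set (Kernel X X × Measure X) :=
  {p | p ∈ T.admissiblePairs ∧
    T.pressure φ = T.abstractEntropy p.1 p.2 + (T.doubleIntegral φ p.1 p.2 : EReal)}

/-- The set `t_φ(X, T)` of tangent functionals to `P(T, ·)` at `φ`. It is used only when
`T` has finite topological entropy, where every `P(T, ψ)` occurring here is finite. -/
def tangentFunctionals {X : Type*} [MetricSpace X] [MeasurableSpace X]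
    (T : Correspondence X) (φ : C(T.orbits 2, ℝ)) : Set (Kernel X X × Measure X) :=
  {p | p ∈ T.admissiblePairs ∧ ∀ ψ : C(T.orbits 2, ℝ),
    T.pressure (φ + ψ) - T.pressure φ ≥ (T.orbitIntegral ψ p.1 p.2 : EReal)}

end Correspondence

/-! A pair is tangent at `φ` exactly when `φ` minimizes P(T,ψ) − ∫ψ d(μ⊗Q) over all `ψ`
(`mem_tangentFunctionals_iff`). Both entropies lie below this quantity for every `ψ`, and an
equilibrium state is a case of equality at `φ`; hence `φ` is a minimizer. For the abstract entropy
the bound comes from the competitor P(T,ψ) − ψ (`abstractEntropy_le`). Conversely, minimality at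
`φ`, tested on −ψ, bounds every competitor `ψ` from below, so the abstract entropy of a tangent pair
equals the minimum. Finite topological entropy makes all pressures real, which keeps this arithmetic
legitimate.

For h_μ(Q) the bound is the variational inequality `kernelEntropy_le`. Gibbs' inequality compares
the law of itineraries with an explicit one: draw a point x of a finite separated cover of the orbit
space with weight proportional to exp(S_nφ(x)), read off cell labels along x, and replace each label
by a uniform one with probability δ. A path shadowed by x has −log probability at most log Z −
S_nφ(x) plus a coding cost, where Z is the sum of the weights. Labels are reliable on compact
subsets of the cells, which miss mass at most δ; by invariance each coordinate is misread with
probability at most δ. A misreading costs only log(k/δ), with k the number of cells, so the cost per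
coordinate vanishes as δ → 0. -/

namespace Correspondence

/-! ### Dependence of the pressure on the potential, and finiteness -/

section Pressure

variable {X : Type*} [MetricSpace X] (T : Correspondence X)

theorem birkhoffSum_le_add {φ ψ : C(T.orbits 2, ℝ)} {c : ℝ} (h : ∀ p, φ p ≤ ψ p + c) (n : ℕ)
    (x : T.orbits (n + 1)) : T.birkhoffSum φ n x ≤ T.birkhoffSum ψ n x + n * c := by
  refine (Finset.sum_le_sum fun i _ => h _).trans_eq ?_
  simp [birkhoffSum, Finset.sum_add_distrib]

theorem sepSum_le_exp_mul {φ ψ : C(T.orbits 2, ℝ)} {c : ℝ} (h : ∀ p, φ p ≤ ψ p + c) (n : ℕ)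
    (ε : ℝ) : T.sepSum φ n ε ≤ ENNReal.ofReal (Real.exp (n * c)) * T.sepSum ψ n ε := by
  refine iSup₂_le fun E hE => ?_
  calc ∑' x : E, ENNReal.ofReal (Real.exp (T.birkhoffSum φ n x))
      ≤ ∑' x : E, ENNReal.ofReal (Real.exp (n * c)) *
          ENNReal.ofReal (Real.exp (T.birkhoffSum ψ n x)) := by
        refine ENNReal.tsum_le_tsum fun x => ?_
        rw [← ENNReal.ofReal_mul (Real.exp_nonneg _), ← Real.exp_add]
        refine ENNReal.ofReal_le_ofReal (Real.exp_le_exp.2 ?_)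
        linarith [T.birkhoffSum_le_add h n x]
    _ = ENNReal.ofReal (Real.exp (n * c)) *
          ∑' x : E, ENNReal.ofReal (Real.exp (T.birkhoffSum ψ n x)) := ENNReal.tsum_mul_left
    _ ≤ _ := by
        gcongr
        exact le_iSup₂_of_le E hE le_rfl

theorem log_ofReal_exp (r : ℝ) : ENNReal.log (ENNReal.ofReal (Real.exp r)) = (r : EReal) := by
  rw [ENNReal.log_ofReal_of_pos (Real.exp_pos r), Real.log_exp]

theorem pressureAt_le_add {φ ψ : C(T.orbits 2, ℝ)} {c : ℝ} (h : ∀ p, φ p ≤ ψ p + c) (ε : ℝ) :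
    T.pressureAt φ ε ≤ T.pressureAt ψ ε + c := by
  have hc : limsup (fun _ : ℕ => (c : EReal)) atTop = c := limsup_const _
  have key : T.pressureAt φ ε ≤ limsup ((fun n : ℕ => ENNReal.log (T.sepSum ψ n ε) / (n : EReal)) +
      fun _ => (c : EReal)) atTop := by
    refine limsup_le_limsup ?_
    filter_upwards [eventually_gt_atTop 0] with n hn
    have hn0 : (0 : EReal) < n := by exact_mod_cast hn
    have hlog := ENNReal.log_monotone (T.sepSum_le_exp_mul h n ε)
    rw [ENNReal.log_mul_add, log_ofReal_exp] at hlog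
    refine (EReal.div_le_div_right_of_nonneg hn0.le hlog).trans_eq ?_
    rw [EReal.add_div_of_nonneg_right hn0.le, add_comm, Pi.add_apply]
    congr 1
    have : ((n * c : ℝ) : EReal) / (n : EReal) = ((n * c / n : ℝ) : EReal) := by
      rw [EReal.coe_div]; rfl
    rw [this, mul_div_cancel_left₀]
    exact_mod_cast hn.ne'
  refine key.trans ((EReal.limsup_add_le ?_ ?_).trans_eq ?_)
  · right; rw [hc]; exact EReal.coe_ne_top c
  · right; rw [hc]; exact EReal.coe_ne_bot c
  · rw [hc]; rfl

theorem pressure_le_add {φ ψ : C(T.orbits 2, ℝ)} {c : ℝ} (h : ∀ p, φ p ≤ ψ p + c) :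
    T.pressure φ ≤ T.pressure ψ + c := by
  refine iSup₂_le fun ε hε => (T.pressureAt_le_add h ε).trans ?_
  gcongr
  exact le_iSup₂_of_le ε hε le_rfl

theorem nonempty_orbits [Nonempty X] (n : ℕ) : (T.orbits n).Nonempty := by
  choose f hf using T.nonempty'
  obtain ⟨x₀⟩ := ‹Nonempty X›
  refine ⟨fun i => f^[i] x₀, fun i h => ?_⟩
  simp only [Function.iterate_succ_apply']
  exact hf _

/-- A single orbit is a separated set of total weight 1. Nonemptiness matters: on the empty space
the pressure is −∞. -/
theorem pressure_zero_nonneg [Nonempty X] : 0 ≤ T.pressure 0 := by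
  refine le_iSup₂_of_le 1 one_pos ?_
  have h0 : limsup (fun _ : ℕ => (0 : EReal)) atTop = 0 := limsup_const _
  rw [← h0]
  refine limsup_le_limsup (Eventually.of_forall fun n => ?_)
  refine EReal.div_nonneg ?_ (Nat.cast_nonneg' n)
  rw [← ENNReal.log_one]
  refine ENNReal.log_monotone ?_
  obtain ⟨x, hx⟩ := T.nonempty_orbits (n + 1)
  refine le_iSup₂_of_le {⟨x, hx⟩} (Set.pairwise_singleton _ _) ?_
  simp [birkhoffSum]

/-- On a nonempty compact space the pressure is real-valued as soon as the topological entropy is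
finite. -/
theorem exists_pressure_eq_coe [CompactSpace X] [Nonempty X] (hT : T.topEntropy < ⊤)
    (φ : C(T.orbits 2, ℝ)) : ∃ p : ℝ, T.pressure φ = p := by
  have : CompactSpace (T.orbits 2) := isCompact_iff_compactSpace.1 (T.isClosed_orbits 2).isCompact
  -- The potentials `φ` and 0 differ by at most `‖φ‖`, so their pressures are both finite or both
  -- infinite.
  have h1 : T.pressure φ ≤ T.pressure 0 + (‖φ‖ : ℝ) := T.pressure_le_add fun p => by
    simpa using φ.apply_le_norm p
  have h2 : T.pressure 0 ≤ T.pressure φ + (‖φ‖ : ℝ) := T.pressure_le_add fun p => by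
    simpa using neg_le_iff_add_nonneg.1 (φ.neg_norm_le_apply p)
  induction hP : T.pressure φ with
  | coe p => exact ⟨p, rfl⟩
  | bot =>
    rw [hP, EReal.bot_add] at h2
    exact absurd (T.pressure_zero_nonneg.trans h2) (by simp)
  | top =>
    rw [hP, top_le_iff] at h1
    exact absurd h1 (EReal.add_lt_top hT.ne (EReal.coe_ne_top _)).ne

end Pressure

end Correspondence

/-! ### Separated covers and Gibbs' inequality -/

/-- Compactness bounds the size of separated sets, and a separated set of maximal size is
automatically a cover. Having both properties lets one set be counted by the pressure and shadow
every orbit. -/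
theorem Metric.exists_finset_separated_cover {Y : Type*} [PseudoMetricSpace Y] [CompactSpace Y]
    {ε : ℝ} (hε : 0 < ε) :
    ∃ E : Finset Y, ((E : Set Y).Pairwise fun x y => ε ≤ dist x y) ∧
      ∀ y, ∃ x ∈ E, dist y x ≤ ε := by
  lift ε to NNReal using hε.le
  have hε' : ε / 2 ≠ 0 := by
    have : 0 < ε := by exact_mod_cast hε
    exact (half_pos this).ne'
  have hfin : Metric.packingNumber ε (Set.univ : Set Y) ≠ ⊤ := by
    obtain ⟨N, -, hN, hcov⟩ := Metric.exists_finite_isCover_of_isCompact hε' (isCompact_univ (X := Y))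
    have h1 := Metric.packingNumber_two_mul_le_externalCoveringNumber (ε / 2) (Set.univ : Set Y)
    rw [mul_div_cancel₀ _ two_ne_zero] at h1
    have h2 := hcov.externalCoveringNumber_le_encard
    exact ((h1.trans h2).trans_lt hN.encard_lt_top).ne
  set C := Metric.maximalSeparatedSet ε (Set.univ : Set Y)
  have hC : C.Finite := by
    rw [← Set.encard_ne_top_iff, Metric.encard_maximalSeparatedSet hfin]
    exact hfin
  refine ⟨hC.toFinset, ?_, fun y => ?_⟩
  · rw [hC.coe_toFinset]
    intro x hx y hy hxy
    have : (ε : ENNReal) < edist x y := Metric.isSeparated_maximalSeparatedSet hx hy hxy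
    rw [edist_nndist] at this
    exact_mod_cast this.le
  · obtain ⟨x, hx, hxy⟩ := Metric.isCover_maximalSeparatedSet hfin (Set.mem_univ y)
    refine ⟨x, hC.mem_toFinset.2 hx, ?_⟩
    have h : edist y x ≤ ε := hxy
    rw [edist_nndist] at h
    exact_mod_cast h

/-- Gibbs' inequality. -/
theorem Real.sum_negMulLog_le_sum_mul_neg_log {α : Type*} [Fintype α] {p q : α → ℝ}
    (hp : ∀ a, 0 ≤ p a) (hq : ∀ a, 0 < q a) (hpq : ∑ a, q a ≤ ∑ a, p a) :
    ∑ a, Real.negMulLog (p a) ≤ ∑ a, p a * -Real.log (q a) := by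
  -- This is log t ≤ t − 1 at t = q/p, multiplied by p; the corrections q − p have nonpositive sum.
  have h : ∀ a, Real.negMulLog (p a) ≤ p a * -Real.log (q a) + (q a - p a) := by
    intro a
    rcases (hp a).eq_or_lt with h0 | h0
    · simp [← h0, (hq a).le]
    · have h1 := Real.log_le_sub_one_of_pos (div_pos (hq a) h0)
      rw [Real.log_div (hq a).ne' h0.ne'] at h1
      have h2 := mul_le_mul_of_nonneg_left h1 h0.le
      have h3 : p a * (q a / p a - 1) = q a - p a := by field_simp
      rw [h3] at h2
      rw [Real.negMulLog]
      linarith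
  calc _ ≤ ∑ a, (p a * -Real.log (q a) + (q a - p a)) := Finset.sum_le_sum fun a _ => h a
    _ ≤ _ := by rw [Finset.sum_add_distrib, Finset.sum_sub_distrib]; linarith

/-! ### Partition entropy as a coding problem -/

namespace FinMeasurablePartition

variable {X : Type*} [MeasurableSpace X] (𝒜 : FinMeasurablePartition X)

theorem exists_mem_cell (x : X) : ∃ j, x ∈ 𝒜.cell j :=
  Set.mem_iUnion.1 (𝒜.iUnion_cell ▸ Set.mem_univ x)

/-- The index of the cell containing a point. -/
noncomputable def index (x : X) : Fin 𝒜.card := (𝒜.exists_mem_cell x).choose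

theorem mem_cell_index (x : X) : x ∈ 𝒜.cell (𝒜.index x) := (𝒜.exists_mem_cell x).choose_spec

theorem index_eq_iff {x : X} {j : Fin 𝒜.card} : 𝒜.index x = j ↔ x ∈ 𝒜.cell j := by
  refine ⟨fun h => h ▸ 𝒜.mem_cell_index x, fun h => ?_⟩
  by_contra hne
  exact Set.disjoint_left.1 (𝒜.disjoint_cell hne) (𝒜.mem_cell_index x) h

theorem measurable_index : Measurable 𝒜.index :=
  measurable_to_countable' fun j => by
    convert 𝒜.measurableSet_cell j using 1
    ext x
    exact 𝒜.index_eq_iff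

/-- The itinerary of a finite sequence of points. -/
noncomputable def itinerary {n : ℕ} (y : Fin n → X) : Fin n → Fin 𝒜.card :=
  fun i => 𝒜.index (y i)

theorem measurable_itinerary {n : ℕ} : Measurable (𝒜.itinerary (n := n)) :=
  measurable_pi_lambda _ fun i => 𝒜.measurable_index.comp (measurable_pi_apply i)

/-- The product partition has the entropy of the itinerary's law, so Gibbs' inequality bounds it by
the expected code length −log q for any positive `q` of mass at most 1. -/
theorem powEntropy_le_integral {n : ℕ} (m : Measure (Fin n → X)) [IsProbabilityMeasure m]
    {q : (Fin n → Fin 𝒜.card) → ℝ} (hq : ∀ a, 0 < q a) (hq1 : ∑ a, q a ≤ 1) :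
    𝒜.powEntropy n m ≤ ∫ y, -Real.log (q (𝒜.itinerary y)) ∂m := by
  have hm : IsProbabilityMeasure (m.map 𝒜.itinerary) :=
    Measure.isProbabilityMeasure_map 𝒜.measurable_itinerary.aemeasurable
  have hcyl : ∀ a : Fin n → Fin 𝒜.card,
      m.real (Set.univ.pi fun i => 𝒜.cell (a i)) = (m.map 𝒜.itinerary).real {a} := by
    intro a
    rw [map_measureReal_apply 𝒜.measurable_itinerary (measurableSet_singleton a)]
    congr 1
    ext y
    simp [Set.mem_pi, ← index_eq_iff, itinerary, funext_iff]
  have hint : ∫ y, -Real.log (q (𝒜.itinerary y)) ∂m =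
      ∑ a, (m.map 𝒜.itinerary).real {a} * -Real.log (q a) := by
    rw [← integral_map (f := fun a => -Real.log (q a)) 𝒜.measurable_itinerary.aemeasurable
      (measurable_of_finite _).aestronglyMeasurable, integral_fintype .of_finite]
    rfl
  rw [hint, powEntropy]
  simp only [hcyl]
  refine Real.sum_negMulLog_le_sum_mul_neg_log (fun a => measureReal_nonneg) hq (hq1.trans_eq ?_)
  rw [sum_measureReal_singleton]
  simp

/-- If almost every `y` is shadowed by some `x ∈ E`, in the sense that `F y ≤ w x` and the label
`c x i` predicts the cell of `y i` whenever `y i ∈ K`, then the entropy is controlled by the weights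
`w` and by the measure of the sets `{y | y i ∉ K}`. -/
theorem powEntropy_le_of_shadowing {n : ℕ} (m : Measure (Fin n → X)) [IsProbabilityMeasure m]
    {α : Type*} (E : Finset α) (w : α → ℝ) (c : α → Fin n → Fin 𝒜.card) {K : Set X}
    (hK : MeasurableSet K) {δ : ℝ} (hδ : 0 < δ) (hδ1 : δ < 1) (hcard : 0 < 𝒜.card)
    {F : (Fin n → X) → ℝ} (hF : Integrable F m)
    (hshadow : ∀ᵐ y ∂m, ∃ x ∈ E, F y ≤ w x ∧ ∀ i, y i ∈ K → c x i = 𝒜.index (y i)) :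
    𝒜.powEntropy n m ≤ Real.log (∑ x ∈ E, Real.exp (w x)) - ∫ y, F y ∂m +
      n * -Real.log (1 - δ) + Real.log (𝒜.card / δ) * ∑ i, m.real {y | y i ∈ Kᶜ} := by
  classical
  have hk : (1 : ℝ) ≤ 𝒜.card := by exact_mod_cast hcard
  have hE : E.Nonempty := by
    obtain ⟨y, x, hx, -⟩ := hshadow.exists
    exact ⟨x, hx⟩
  set Z := ∑ x ∈ E, Real.exp (w x)
  have hZ : 0 < Z := Finset.sum_pos (fun x _ => Real.exp_pos _) hE
  -- Noisy channel: the label `d` is kept with probability 1 − δ and otherwise resampled uniformly.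
  -- The noise keeps every −log r finite.
  let r : Fin 𝒜.card → Fin 𝒜.card → ℝ := fun b d => (if b = d then 1 - δ else 0) + δ / 𝒜.card
  have hδk : 0 < δ / 𝒜.card := by positivity
  have hr : ∀ b d, 0 < r b d := by
    intro b d
    simp only [r]
    split_ifs <;> linarith
  have hr1 : ∀ d, ∑ b, r b d = 1 := by
    intro d
    simp only [r, Finset.sum_add_distrib, Finset.sum_ite_eq', Finset.mem_univ, if_true,
      Finset.sum_const, Finset.card_univ, Fintype.card_fin, nsmul_eq_mul]
    field_simp
    ring
  -- Law of the label word of a Gibbs-random point of `E`, sent through the channel coordinate by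
  -- coordinate.
  let q : (Fin n → Fin 𝒜.card) → ℝ := fun a => ∑ x ∈ E, Real.exp (w x) / Z * ∏ i, r (a i) (c x i)
  have hterm : ∀ (a : Fin n → Fin 𝒜.card) (x : α),
      0 < Real.exp (w x) / Z * ∏ i, r (a i) (c x i) := fun a x =>
    mul_pos (div_pos (Real.exp_pos _) hZ) (Finset.prod_pos fun i _ => hr _ _)
  have hq : ∀ a, 0 < q a := fun a => Finset.sum_pos (fun x _ => hterm a x) hE
  have hq1 : ∑ a, q a = 1 := by
    simp only [q]
    rw [Finset.sum_comm]
    have : ∀ x ∈ E, ∑ a : Fin n → Fin 𝒜.card,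
        Real.exp (w x) / Z * ∏ i, r (a i) (c x i) = Real.exp (w x) / Z := by
      intro x _
      rw [← Finset.mul_sum, ← Fintype.prod_sum (fun (i : Fin n) b => r b (c x i))]
      simp [hr1]
    rw [Finset.sum_congr rfl this, ← Finset.sum_div, div_self hZ.ne']
  set L := Real.log (𝒜.card / δ)
  have hL : L = -Real.log (δ / 𝒜.card) := by rw [← Real.log_inv, inv_div]
  have hL0 : 0 ≤ L := Real.log_nonneg ((one_le_div hδ).2 (by linarith))
  have hδ0 : 0 ≤ -Real.log (1 - δ) := by
    linarith [Real.log_nonpos (by linarith : 0 ≤ 1 - δ) (by linarith)]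
  have hmeas : ∀ i : Fin n, MeasurableSet {y : Fin n → X | y i ∈ Kᶜ} := fun i =>
    measurable_pi_apply i hK.compl
  have hind : ∀ i : Fin n, Integrable ({y : Fin n → X | y i ∈ Kᶜ}.indicator fun _ => (1 : ℝ)) m :=
    fun i => (integrable_const 1).indicator (hmeas i)
  let G : (Fin n → X) → ℝ := fun y => Real.log Z - F y + n * -Real.log (1 - δ) +
    L * ∑ i, {y : Fin n → X | y i ∈ Kᶜ}.indicator (fun _ => (1 : ℝ)) y
  have hG1 : Integrable (fun y => Real.log Z - F y) m := (integrable_const _).sub hF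
  have hG2 : Integrable (fun y => Real.log Z - F y + n * -Real.log (1 - δ)) m :=
    hG1.add (integrable_const _)
  have hG3 : Integrable
      (fun y => L * ∑ i, {y : Fin n → X | y i ∈ Kᶜ}.indicator (fun _ => (1 : ℝ)) y) m :=
    (integrable_finsetSum _ fun i _ => hind i).const_mul L
  have hlogr : ∀ (y : Fin n → X) (x : α) (i : Fin n), (y i ∈ K → c x i = 𝒜.index (y i)) →
      -Real.log (r (𝒜.itinerary y i) (c x i)) ≤ -Real.log (1 - δ) +
        L * {y : Fin n → X | y i ∈ Kᶜ}.indicator (fun _ => (1 : ℝ)) y := by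
    intro y x i h
    by_cases hy : y i ∈ K
    · have h1 : r (𝒜.itinerary y i) (c x i) = 1 - δ + δ / 𝒜.card := by
        simp [r, itinerary, h hy]
      have h2 := Real.log_le_log (by linarith : 0 < 1 - δ)
        (by linarith : 1 - δ ≤ 1 - δ + δ / 𝒜.card)
      simp only [h1, Set.indicator, Set.mem_ofPred_eq, Set.mem_compl_iff, hy, not_true, if_false]
      linarith
    · have h1 : δ / 𝒜.card ≤ r (𝒜.itinerary y i) (c x i) := by
        simp only [r]
        split_ifs <;> linarith
      have h2 := Real.log_le_log hδk h1
      simp only [Set.indicator, Set.mem_ofPred_eq, Set.mem_compl_iff, hy, not_false_eq_true, if_true]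
      linarith
  have hpt : ∀ᵐ y ∂m, -Real.log (q (𝒜.itinerary y)) ≤ G y := by
    filter_upwards [hshadow] with y hy
    obtain ⟨x, hx, hFw, hlab⟩ := hy
    -- Only the summand of the shadowing point is kept.
    have h1 : Real.exp (w x) / Z * ∏ i, r (𝒜.itinerary y i) (c x i) ≤ q (𝒜.itinerary y) :=
      Finset.single_le_sum (f := fun x => Real.exp (w x) / Z * ∏ i, r (𝒜.itinerary y i) (c x i))
        (fun x _ => (hterm _ x).le) hx
    have h2 := Real.log_le_log (hterm _ x) h1
    rw [Real.log_mul (div_pos (Real.exp_pos _) hZ).ne' (Finset.prod_pos fun i _ => hr _ _).ne',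
      Real.log_div (Real.exp_pos _).ne' hZ.ne', Real.log_exp,
      Real.log_prod fun i _ => (hr _ _).ne'] at h2
    have h3 := Finset.sum_le_sum fun i (_ : i ∈ Finset.univ) => hlogr y x i (hlab i)
    rw [Finset.sum_neg_distrib, Finset.sum_add_distrib, ← Finset.mul_sum] at h3
    simp only [Finset.sum_const, Finset.card_univ, Fintype.card_fin, nsmul_eq_mul] at h3
    simp only [G]
    linarith
  refine (𝒜.powEntropy_le_integral m hq hq1.le).trans ?_
  refine (integral_mono_ae ?_ (hG2.add hG3) hpt).trans_eq ?_
  · refine Integrable.of_bound (C := ∑ a, |Real.log (q a)|) ?_ ?_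
    · exact ((measurable_of_finite fun a => -Real.log (q a)).comp
        𝒜.measurable_itinerary).aestronglyMeasurable
    · refine Eventually.of_forall fun y => ?_
      rw [norm_neg, Real.norm_eq_abs]
      exact Finset.single_le_sum (f := fun a => |Real.log (q a)|) (fun a _ => abs_nonneg _)
        (Finset.mem_univ _)
  · rw [integral_add' hG2 hG3, integral_add hG1 (integrable_const _),
      integral_sub (integrable_const _) hF, integral_const_mul L,
      integral_finsetSum _ fun i _ => hind i]
    have hone : ∀ i : Fin n, ∫ y, {y : Fin n → X | y i ∈ Kᶜ}.indicator (fun _ => (1 : ℝ)) y ∂m =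
        m.real {y | y i ∈ Kᶜ} := fun i => integral_indicator_one (hmeas i)
    simp only [hone, integral_const, probReal_univ, one_smul]

end FinMeasurablePartition

/-! ### Marginals of the path laws -/

theorem map_bind_kernelPath_zero {X : Type*} [MeasurableSpace X] (Q : Kernel X X)
    (μ : Measure X) : (μ.bind (kernelPath Q 0)).map (fun y => y (Fin.last 0)) = μ := by
  rw [kernelPath, Measure.deterministic_comp_eq_map, Measure.map_map (by fun_prop) (by fun_prop)]
  exact Measure.map_id

section PathLaw

variable {X : Type*} [MeasurableSpace X] (Q : Kernel X X) [IsMarkovKernel Q]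
  (μ : Measure X) [IsProbabilityMeasure μ]

theorem bind_kernelPath_succ (n : ℕ) :
    μ.bind (kernelPath Q (n + 1)) =
      (μ.bind (kernelPath Q n) ⊗ₘ Q.comap (fun y => y (Fin.last n)) (measurable_pi_apply _)).map
        (fun p => (Fin.snoc p.1 p.2 : Fin (n + 2) → X)) := by
  ext A hA
  have hA' := measurable_snoc (n + 1) hA
  rw [Measure.bind_apply hA (Kernel.aemeasurable _), Measure.map_apply (measurable_snoc _) hA,
    Measure.compProd_apply hA', Measure.lintegral_bind (Kernel.aemeasurable _)]
  · simp only [kernelPath_succ_apply Q n _ hA]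
    rfl
  · exact (Kernel.measurable_kernel_prodMk_left hA').aemeasurable

theorem map_init_bind_kernelPath (n : ℕ) :
    (μ.bind (kernelPath Q (n + 1))).map (fun y (i : Fin (n + 1)) => y i.castSucc) =
      μ.bind (kernelPath Q n) := by
  rw [bind_kernelPath_succ, Measure.map_map (by fun_prop) (measurable_snoc _)]
  simp only [Function.comp_def, Fin.snoc_castSucc]
  exact Measure.fst_compProd _ _

/-- Markov property: the new point depends on the path only through its last coordinate. No
invariance is needed here. -/
theorem map_last_pair_bind_kernelPath (n : ℕ) :
    (μ.bind (kernelPath Q (n + 1))).map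
        (fun y => (y (Fin.last n).castSucc, y (Fin.last n).succ)) =
      (μ.bind (kernelPath Q n)).map (fun y => y (Fin.last n)) ⊗ₘ Q := by
  rw [bind_kernelPath_succ, Measure.map_map (by fun_prop) (measurable_snoc _)]
  simp only [Function.comp_def, Fin.snoc_castSucc, Fin.succ_last, Fin.snoc_last]
  have : IsProbabilityMeasure ((μ.bind (kernelPath Q n)).map (fun y => y (Fin.last n))) :=
    Measure.isProbabilityMeasure_map (measurable_pi_apply _).aemeasurable
  ext A hA
  rw [Measure.map_apply (by fun_prop) hA, Measure.compProd_apply hA,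
    Measure.compProd_apply ((by fun_prop : Measurable fun p : (Fin (n + 1) → X) × X =>
      (p.1 (Fin.last n), p.2)) hA),
    lintegral_map (Kernel.measurable_kernel_prodMk_left hA) (by fun_prop)]
  rfl

/-- The law of `(x₁, x₂)` under `μ Q^{[1]}` is `μ ⊗ Q`. -/
theorem map_pair_bind_kernelPath_one :
    (μ.bind (kernelPath Q 1)).map (fun y => (y 0, y 1)) = μ ⊗ₘ Q := by
  have h := map_last_pair_bind_kernelPath Q μ 0
  rwa [map_bind_kernelPath_zero] at h

variable {Q μ}

theorem map_last_bind_kernelPath (hμ : Q.Invariant μ) (n : ℕ) :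
    (μ.bind (kernelPath Q n)).map (fun y => y (Fin.last n)) = μ := by
  induction n with
  | zero => exact map_bind_kernelPath_zero Q μ
  | succ n ih =>
    have h := map_last_pair_bind_kernelPath Q μ n
    rw [ih] at h
    have h2 := congrArg Measure.snd h
    rw [Measure.snd_compProd, Measure.snd, Measure.map_map (by fun_prop) (by fun_prop)] at h2
    exact h2.trans hμ

/-- Under an invariant measure every coordinate of a path has law `μ`. -/
theorem map_eval_bind_kernelPath (hμ : Q.Invariant μ) (n : ℕ) (i : Fin (n + 1)) :
    (μ.bind (kernelPath Q n)).map (fun y => y i) = μ := by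
  induction n with
  | zero =>
    obtain rfl : i = Fin.last 0 := Fin.ext (by simp)
    exact map_last_bind_kernelPath hμ 0
  | succ n ih =>
    refine Fin.lastCases (map_last_bind_kernelPath hμ _) (fun j => ?_) i
    have h := ih j
    rw [← map_init_bind_kernelPath Q μ n, Measure.map_map (by fun_prop) (by fun_prop)] at h
    exact h

/-- Under an invariant measure every pair of consecutive coordinates of a path has law `μ ⊗ Q`. -/
theorem map_pair_bind_kernelPath (hμ : Q.Invariant μ) (n : ℕ) (i : Fin n) :
    (μ.bind (kernelPath Q n)).map (fun y => (y i.castSucc, y i.succ)) = μ ⊗ₘ Q := by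
  induction n with
  | zero => exact i.elim0
  | succ n ih =>
    refine Fin.lastCases ?_ (fun j => ?_) i
    · rw [map_last_pair_bind_kernelPath, map_last_bind_kernelPath hμ]
    · rw [← ih j, ← map_init_bind_kernelPath Q μ n, Measure.map_map (by fun_prop) (by fun_prop)]
      rfl

end PathLaw

/-! ### Integrals over the orbit space as integrals against μ ⊗ Q -/

namespace Correspondence

variable {X : Type*} [MetricSpace X] (T : Correspondence X)

/-- A continuous function on `𝒪_2(T)` extends to a continuous function on `X × X`. -/
theorem exists_extension (φ : C(T.orbits 2, ℝ)) :
    ∃ Φ : C(X × X, ℝ), ∀ p : T.orbits 2, φ p = Φ (p.1 0, p.1 1) := by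
  -- Tietze extension from the closed set 𝒪_2(T).
  obtain ⟨Ψ, hΨ⟩ := ContinuousMap.exists_restrict_eq (T.isClosed_orbits 2) φ
  refine ⟨⟨fun p => Ψ ![p.1, p.2], by fun_prop⟩, fun p => ?_⟩
  rw [← hΨ]
  simp only [ContinuousMap.restrict_apply, ContinuousMap.coe_mk]
  congr 1
  ext i
  fin_cases i <;> rfl

theorem mem_orbits_two {y : Fin 2 → X} : y ∈ T.orbits 2 ↔ y 1 ∈ T (y 0) := by
  refine ⟨fun h => h 0 (by omega), fun h i hi => ?_⟩
  obtain rfl : i = 0 := by omega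
  exact h

theorem mem_orbits_iff {n : ℕ} {y : Fin (n + 1) → X} :
    y ∈ T.orbits (n + 1) ↔ ∀ i : Fin n, y i.succ ∈ T (y i.castSucc) :=
  ⟨fun h i => h i.1 (Nat.succ_lt_succ i.2), fun h i hi => h ⟨i, Nat.lt_of_succ_lt_succ hi⟩⟩

theorem isClosed_graph : IsClosed {p : X × X | p.2 ∈ T p.1} := by
  have h : Continuous fun p : X × X => ![p.1, p.2] := by fun_prop
  convert (T.isClosed_orbits 2).preimage h using 1
  ext p
  simp [mem_orbits_two]

variable [CompactSpace X] [MeasurableSpace X] [BorelSpace X] {Q : Kernel X X} [IsMarkovKernel Q]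
  {μ : Measure X} [IsProbabilityMeasure μ]

theorem ae_mem_of_supports (hQ : T.Supports Q) : ∀ᵐ p ∂(μ ⊗ₘ Q), p.2 ∈ T p.1 := by
  rw [Measure.ae_compProd_iff T.isClosed_graph.measurableSet]
  refine Eventually.of_forall fun x => ?_
  exact (prob_compl_eq_zero_iff (T.isClosed' x).measurableSet).2 (hQ x)

theorem integrable_continuousMap (Φ : C(X × X, ℝ)) (ν : Measure (X × X)) [IsFiniteMeasure ν] :
    Integrable Φ ν :=
  Integrable.of_bound Φ.continuous.measurable.aestronglyMeasurable ‖Φ‖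
    (Eventually.of_forall fun p => Φ.norm_coe_le_norm p)

/-- Each `Q x` is carried by `T x`, so the subtype integral is a full integral and Fubini applies.
Linearity and the comparison with `orbitIntegral` are then read off on X × X. -/
theorem doubleIntegral_eq (hQ : T.Supports Q) {φ : C(T.orbits 2, ℝ)} {Φ : C(X × X, ℝ)}
    (h : ∀ p : T.orbits 2, φ p = Φ (p.1 0, p.1 1)) :
    T.doubleIntegral φ Q μ = ∫ p, Φ p ∂(μ ⊗ₘ Q) := by
  rw [Measure.integral_compProd (integrable_continuousMap Φ _), doubleIntegral]
  congr 1 with x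
  have hx := integral_subtype_comap (μ := Q x) (T.isClosed' x).measurableSet
    (fun y => Φ (x, y))
  have hmem : ∀ᵐ y ∂(Q x), y ∈ T x :=
    (prob_compl_eq_zero_iff (T.isClosed' x).measurableSet).2 (hQ x)
  rw [Measure.restrict_eq_self_of_ae_mem hmem] at hx
  rw [← hx]
  simp only [h]
  rfl

theorem orbitIntegral_eq (hQ : T.Supports Q) {φ : C(T.orbits 2, ℝ)} {Φ : C(X × X, ℝ)}
    (h : ∀ p : T.orbits 2, φ p = Φ (p.1 0, p.1 1)) :
    T.orbitIntegral φ Q μ = ∫ p, Φ p ∂(μ ⊗ₘ Q) := by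
  have hmem : ∀ᵐ y ∂(μ.bind (kernelPath Q 1)), y ∈ T.orbits 2 := by
    simp only [mem_orbits_two]
    have := T.ae_mem_of_supports (μ := μ) hQ
    rw [← map_pair_bind_kernelPath_one] at this
    exact ae_of_ae_map (by fun_prop) this
  have hx := integral_subtype_comap (μ := μ.bind (kernelPath Q 1))
    (T.isClosed_orbits 2).measurableSet (fun y => Φ (y 0, y 1))
  rw [Measure.restrict_eq_self_of_ae_mem hmem] at hx
  rw [← map_pair_bind_kernelPath_one, integral_map (by fun_prop)
    Φ.continuous.measurable.aestronglyMeasurable, ← hx]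
  simp only [orbitIntegral, h]

theorem orbitIntegral_eq_doubleIntegral (hQ : T.Supports Q) (φ : C(T.orbits 2, ℝ)) :
    T.orbitIntegral φ Q μ = T.doubleIntegral φ Q μ := by
  obtain ⟨Φ, hΦ⟩ := T.exists_extension φ
  rw [T.orbitIntegral_eq hQ hΦ, T.doubleIntegral_eq hQ hΦ]

theorem doubleIntegral_add (hQ : T.Supports Q) (φ ψ : C(T.orbits 2, ℝ)) :
    T.doubleIntegral (φ + ψ) Q μ = T.doubleIntegral φ Q μ + T.doubleIntegral ψ Q μ := by
  obtain ⟨Φ, hΦ⟩ := T.exists_extension φ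
  obtain ⟨Ψ, hΨ⟩ := T.exists_extension ψ
  rw [T.doubleIntegral_eq hQ hΦ, T.doubleIntegral_eq hQ hΨ,
    T.doubleIntegral_eq (Φ := Φ + Ψ) hQ fun p => by simp [hΦ, hΨ]]
  exact integral_add (integrable_continuousMap Φ _) (integrable_continuousMap Ψ _)

theorem doubleIntegral_neg (hQ : T.Supports Q) (φ : C(T.orbits 2, ℝ)) :
    T.doubleIntegral (-φ) Q μ = -T.doubleIntegral φ Q μ := by
  obtain ⟨Φ, hΦ⟩ := T.exists_extension φ
  rw [T.doubleIntegral_eq hQ hΦ, T.doubleIntegral_eq (Φ := -Φ) hQ fun p => by simp [hΦ]]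
  exact integral_neg _

theorem doubleIntegral_const (hQ : T.Supports Q) (c : ℝ) :
    T.doubleIntegral (ContinuousMap.const _ c) Q μ = c := by
  rw [T.doubleIntegral_eq (Φ := ContinuousMap.const _ c) hQ fun p => by simp]
  simp

end Correspondence

/-! ### Compact approximation of partitions and the coding cost -/

theorem FinMeasurablePartition.exists_isCompact_subset_cell {X : Type*} [MetricSpace X]
    [CompactSpace X] [MeasurableSpace X] [BorelSpace X] (𝒜 : FinMeasurablePartition X)
    (μ : Measure X) [IsFiniteMeasure μ] {δ : ℝ} (hδ : 0 < δ) :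
    ∃ K : Fin 𝒜.card → Set X, (∀ j, IsCompact (K j)) ∧ (∀ j, K j ⊆ 𝒜.cell j) ∧
      μ.real (⋃ j, K j)ᶜ ≤ δ := by
  -- The `+ 1` keeps `η` positive even for a partition with no cells.
  set η : ℝ := δ / (𝒜.card + 1)
  have hη : 0 < η := by positivity
  have h := fun j => (𝒜.measurableSet_cell j).exists_isCompact_sdiff_lt (μ := μ)
    (measure_ne_top _ _) (ENNReal.ofReal_pos.2 hη).ne'
  choose K hKsub hK hμK using h
  refine ⟨K, hK, hKsub, ?_⟩
  have hsub : (⋃ j, K j)ᶜ ⊆ ⋃ j, 𝒜.cell j \ K j := by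
    intro x hx
    obtain ⟨j, hj⟩ := 𝒜.exists_mem_cell x
    exact Set.mem_iUnion.2 ⟨j, hj, fun hxj => hx (Set.mem_iUnion.2 ⟨j, hxj⟩)⟩
  calc μ.real (⋃ j, K j)ᶜ ≤ μ.real (⋃ j, 𝒜.cell j \ K j) := measureReal_mono hsub
    _ ≤ ∑ j, μ.real (𝒜.cell j \ K j) := measureReal_iUnion_fintype_le _
    _ ≤ ∑ _j : Fin 𝒜.card, η := Finset.sum_le_sum fun j _ =>
        ENNReal.toReal_le_of_le_ofReal hη.le (hμK j).le
    _ = 𝒜.card * η := by simp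
    _ ≤ (𝒜.card + 1) * η := by gcongr; linarith
    _ = δ := by simp only [η]; field_simp

/-- Finitely many disjoint compact sets have disjoint thickenings, so that a point close to their
union can be labelled by the set it is close to. -/
theorem exists_thickening_label {X ι : Type*} [MetricSpace X] [Finite ι] [Nonempty ι]
    {K : ι → Set X} (hK : ∀ j, IsCompact (K j)) (hdisj : Pairwise fun i j => Disjoint (K i) (K j)) :
    ∃ g : ℝ → X → ι, ∀ᶠ ε in 𝓝[>] (0 : ℝ), ∀ j, ∀ x ∈ Metric.thickening ε (K j), g ε x = j := by
  classical
  obtain ⟨j₀⟩ := ‹Nonempty ι›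
  refine ⟨fun ε x => if h : ∃ j, x ∈ Metric.thickening ε (K j) then h.choose else j₀, ?_⟩
  have hev : ∀ᶠ ε in 𝓝[>] (0 : ℝ), ∀ i j, i ≠ j →
      Disjoint (Metric.thickening ε (K i)) (Metric.thickening ε (K j)) := by
    refine eventually_all.2 fun i => eventually_all.2 fun j => ?_
    by_cases hij : i = j
    · exact Eventually.of_forall fun ε h => absurd hij h
    obtain ⟨δ, hδ, hd⟩ := (hdisj hij).exists_thickenings (hK i) (hK j).isClosed
    filter_upwards [Ioo_mem_nhdsGT hδ] with ε hε _
    exact hd.mono (Metric.thickening_mono hε.2.le _) (Metric.thickening_mono hε.2.le _)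
  filter_upwards [hev] with ε hε j x hx
  have hex : ∃ j, x ∈ Metric.thickening ε (K j) := ⟨j, hx⟩
  rw [dif_pos hex]
  by_contra hne
  exact Set.disjoint_left.1 (hε _ _ hne) hex.choose_spec hx

/-- The expression is the coding cost per coordinate: −log(1 − δ) always, and log(k/δ) with
frequency at most δ. It vanishes because δ log δ → 0. -/
theorem tendsto_neg_log_one_sub_add_log_div_mul {k : ℝ} (hk : 0 < k) :
    Tendsto (fun δ : ℝ => -Real.log (1 - δ) + Real.log (k / δ) * δ) (𝓝[>] 0) (𝓝 0) := by
  have h : Tendsto (fun δ : ℝ => -Real.log (1 - δ) + (Real.log k * δ + Real.negMulLog δ))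
      (𝓝[>] 0) (𝓝 0) := by
    have hc : ContinuousAt
        (fun δ : ℝ => -Real.log (1 - δ) + (Real.log k * δ + Real.negMulLog δ)) 0 := by
      refine ContinuousAt.add (ContinuousAt.neg (ContinuousAt.log (by fun_prop) (by norm_num)))
        (ContinuousAt.add (by fun_prop) Real.continuous_negMulLog.continuousAt)
    have h0 := hc.tendsto
    simp only [sub_zero, Real.log_one, neg_zero, mul_zero, Real.negMulLog_zero, add_zero] at h0
    exact h0.mono_left nhdsWithin_le_nhds
  refine h.congr' ?_
  filter_upwards [self_mem_nhdsWithin] with δ hδ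
  rw [Real.log_div hk.ne' (ne_of_gt hδ), Real.negMulLog]
  ring

/-! ### The variational inequality -/

namespace Correspondence

variable {X : Type*} [MetricSpace X] (T : Correspondence X)

theorem log_sum_exp_le_of_log_sepSum_le {φ : C(T.orbits 2, ℝ)} {n : ℕ} {ε c : ℝ}
    (h : ENNReal.log (T.sepSum φ n ε) ≤ c) {E : Finset (T.orbits (n + 1))} (hE : E.Nonempty)
    (hsep : (E : Set (T.orbits (n + 1))).Pairwise fun x y => ε ≤ dist x y) :
    Real.log (∑ x ∈ E, Real.exp (T.birkhoffSum φ n x)) ≤ c := by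
  have h1 : ENNReal.ofReal (∑ x ∈ E, Real.exp (T.birkhoffSum φ n x)) ≤ T.sepSum φ n ε := by
    refine le_iSup₂_of_le (E : Set (T.orbits (n + 1))) hsep ?_
    rw [ENNReal.ofReal_sum_of_nonneg fun x _ => (Real.exp_pos _).le]
    exact (Finset.tsum_subtype' E
      fun x => ENNReal.ofReal (Real.exp (T.birkhoffSum φ n x))).ge
  have h2 := (ENNReal.log_monotone h1).trans h
  rw [ENNReal.log_ofReal_of_pos (Finset.sum_pos (fun x _ => Real.exp_pos _) hE)] at h2
  exact_mod_cast h2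

variable [CompactSpace X] [MeasurableSpace X] [BorelSpace X] {Q : Kernel X X} [IsMarkovKernel Q]
  {μ : Measure X} [IsProbabilityMeasure μ]

theorem ae_mem_orbits (hQ : T.Supports Q) (hμ : Q.Invariant μ) (n : ℕ) :
    ∀ᵐ y ∂(μ.bind (kernelPath Q n)), y ∈ T.orbits (n + 1) := by
  simp only [mem_orbits_iff]
  refine ae_all_iff.2 fun i => ?_
  have := T.ae_mem_of_supports (μ := μ) hQ
  rw [← map_pair_bind_kernelPath hμ n i] at this
  exact ae_of_ae_map (by fun_prop) this

theorem integral_sum_bind_kernelPath (hμ : Q.Invariant μ) (Φ : C(X × X, ℝ)) (n : ℕ) :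
    Integrable (fun y : Fin (n + 1) → X => ∑ i : Fin n, Φ (y i.castSucc, y i.succ))
        (μ.bind (kernelPath Q n)) ∧
      ∫ y, ∑ i : Fin n, Φ (y i.castSucc, y i.succ) ∂(μ.bind (kernelPath Q n)) =
        n * ∫ p, Φ p ∂(μ ⊗ₘ Q) := by
  have hint : ∀ i : Fin n, Integrable (fun y : Fin (n + 1) → X => Φ (y i.castSucc, y i.succ))
      (μ.bind (kernelPath Q n)) := by
    intro i
    have h := integrable_continuousMap Φ (μ ⊗ₘ Q)
    rw [← map_pair_bind_kernelPath hμ n i] at h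
    exact h.comp_measurable (by fun_prop)
  refine ⟨integrable_finsetSum _ fun i _ => hint i, ?_⟩
  rw [integral_finsetSum _ fun i _ => hint i]
  have h : ∀ i : Fin n, ∫ y, Φ (y i.castSucc, y i.succ) ∂(μ.bind (kernelPath Q n)) =
      ∫ p, Φ p ∂(μ ⊗ₘ Q) := by
    intro i
    rw [← map_pair_bind_kernelPath hμ n i, integral_map (by fun_prop)
      Φ.continuous.measurable.aestronglyMeasurable]
  simp [h]

/-- Orbits are coded by an ε/2-separated cover. One `ω` pays for the oscillation of the potential at
scale ε, the other for the noisy labels. -/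
theorem kernelEntropyOf_le (hQ : T.Supports Q) (hμ : Q.Invariant μ) (φ : C(T.orbits 2, ℝ))
    {c : ℝ} (hc : T.pressure φ < c) {ω : ℝ} (hω : 0 < ω) (𝒜 : FinMeasurablePartition X) :
    kernelEntropyOf Q μ 𝒜 ≤ ((c - T.doubleIntegral φ Q μ + 2 * ω : ℝ) : EReal) := by
  obtain ⟨Φ, hΦ⟩ := T.exists_extension φ
  rw [T.doubleIntegral_eq hQ hΦ]
  set I := ∫ p, Φ p ∂(μ ⊗ₘ Q)
  obtain ⟨x₀⟩ : Nonempty X := nonempty_of_isProbabilityMeasure μ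
  have hcard : 0 < 𝒜.card := (𝒜.index x₀).pos
  have : Nonempty (Fin 𝒜.card) := ⟨𝒜.index x₀⟩
  obtain ⟨δ, hκ, hδ, hδ1⟩ : ∃ δ : ℝ,
      -Real.log (1 - δ) + Real.log (𝒜.card / δ) * δ < ω ∧ 0 < δ ∧ δ < 1 :=
    (((tendsto_neg_log_one_sub_add_log_div_mul (Nat.cast_pos.2 hcard)).eventually_lt_const
      hω).and (Ioo_mem_nhdsGT one_pos)).exists
  obtain ⟨K, hK, hKsub, hμK⟩ := 𝒜.exists_isCompact_subset_cell μ hδ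
  obtain ⟨g, hg⟩ := exists_thickening_label hK fun i j hij =>
    (𝒜.disjoint_cell hij).mono (hKsub i) (hKsub j)
  obtain ⟨ε₁, hε₁, hunif⟩ := Metric.uniformContinuous_iff.1
    (CompactSpace.uniformContinuous_of_continuous Φ.continuous) ω hω
  obtain ⟨ε, hgε, hε, hεε₁⟩ := (hg.and (Ioo_mem_nhdsGT hε₁)).exists
  -- Shadowing within ε/2 gives coordinate distances strictly below ε, as open thickenings and
  -- uniform continuity require.
  have hP : T.pressureAt φ (ε / 2) < c :=
    (le_iSup₂_of_le (f := fun ε (_ : 0 < ε) => T.pressureAt φ ε) (ε / 2) (half_pos hε)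
      le_rfl).trans_lt hc
  have hL0 : 0 ≤ Real.log (𝒜.card / δ) := by
    have hk : (1 : ℝ) ≤ 𝒜.card := by exact_mod_cast hcard
    exact Real.log_nonneg ((one_le_div hδ).2 (by linarith))
  -- A path of n + 1 coordinates has only n transitions, hence the factor n/(n + 1) on the potential
  -- part.
  have hbound : ∀ᶠ n : ℕ in atTop,
      𝒜.powEntropy (n + 1) (μ.bind (kernelPath Q n)) / ((n : ℝ) + 1) ≤
        (n : ℝ) / (n + 1) * (c - I + ω) + ω := by
    filter_upwards [eventually_lt_of_limsup_lt hP, eventually_gt_atTop 0] with n hn hn0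
    have hn0' : (0 : EReal) < n := by exact_mod_cast hn0
    have hlog : ENNReal.log (T.sepSum φ n (ε / 2)) ≤ ((n * c : ℝ) : EReal) := by
      rw [EReal.div_lt_iff hn0' (EReal.natCast_ne_top n)] at hn
      rw [mul_comm, EReal.coe_mul]
      exact hn.le
    have : CompactSpace (T.orbits (n + 1)) :=
      isCompact_iff_compactSpace.1 (T.isClosed_orbits (n + 1)).isCompact
    obtain ⟨E, hsep, hcov⟩ := Metric.exists_finset_separated_cover (Y := T.orbits (n + 1))
      (half_pos hε)
    have hEne : E.Nonempty := by
      have : Nonempty X := ⟨x₀⟩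
      obtain ⟨y, hy⟩ := T.nonempty_orbits (n + 1)
      obtain ⟨x, hx, -⟩ := hcov ⟨y, hy⟩
      exact ⟨x, hx⟩
    have hZ := T.log_sum_exp_le_of_log_sepSum_le hlog hEne hsep
    obtain ⟨hint, hsum⟩ := integral_sum_bind_kernelPath hμ Φ n
    have hKm : MeasurableSet (⋃ j, K j) := MeasurableSet.iUnion fun j => (hK j).measurableSet
    -- Here `F` is the Birkhoff sum of `Φ` lowered by nω, so that it lies below the Birkhoff sum at
    -- the shadowing point.
    have hmain := 𝒜.powEntropy_le_of_shadowing (μ.bind (kernelPath Q n)) E (T.birkhoffSum φ n)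
      (fun x i => g ε (x.1 i)) hKm hδ hδ1 hcard (hint.sub (integrable_const (n * ω))) ?_
    · have hbad : ∀ i : Fin (n + 1),
          (μ.bind (kernelPath Q n)).real {y | y i ∈ (⋃ j, K j)ᶜ} ≤ δ := by
        intro i
        have h := map_measureReal_apply (μ := μ.bind (kernelPath Q n)) (measurable_pi_apply i)
          hKm.compl
        rw [map_eval_bind_kernelPath hμ n i] at h
        exact h.symm.trans_le hμK
      have hbad' := Finset.sum_le_sum fun i (_ : i ∈ Finset.univ) => hbad i
      simp only [Finset.sum_const, Finset.card_univ, Fintype.card_fin, nsmul_eq_mul] at hbad'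
      have hbad'' := mul_le_mul_of_nonneg_left hbad' hL0
      simp only [Pi.sub_apply] at hmain
      rw [integral_sub hint (integrable_const _), hsum] at hmain
      simp only [integral_const, probReal_univ, one_smul] at hmain
      push_cast at hmain hbad''
      have hn1 : (0 : ℝ) < n + 1 := by positivity
      have hκ' := mul_le_mul_of_nonneg_left hκ.le hn1.le
      rw [div_le_iff₀ hn1]
      have : ((n : ℝ) / (n + 1) * (c - I + ω) + ω) * (n + 1) =
          n * (c - I + ω) + (n + 1) * ω := by field_simp
      rw [this]
      linarith
    · filter_upwards [T.ae_mem_orbits hQ hμ n] with y hy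
      obtain ⟨x, hxE, hx⟩ := hcov ⟨y, hy⟩
      have hd : ∀ i, dist (y i) (x.1 i) < ε := fun i =>
        ((dist_le_pi_dist y x.1 i).trans hx).trans_lt (half_lt_self hε)
      refine ⟨x, hxE, ?_, fun i hi => ?_⟩
      · have hle : ∀ i : Fin n, Φ (y i.castSucc, y i.succ) ≤
            φ (T.pair (x.1 i.castSucc) ⟨x.1 i.succ, x.2 i.1 (Nat.succ_lt_succ i.2)⟩) + ω := by
          intro i
          have h1 := hunif (a := (y i.castSucc, y i.succ)) (b := (x.1 i.castSucc, x.1 i.succ))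
            (max_lt ((hd _).trans hεε₁) ((hd _).trans hεε₁))
          have h2 := (abs_lt.1 h1).2
          rw [hΦ]
          change _ ≤ Φ (x.1 i.castSucc, x.1 i.succ) + ω
          linarith
        have h := Finset.sum_le_sum fun i (_ : i ∈ Finset.univ) => hle i
        rw [Finset.sum_add_distrib] at h
        simp only [Finset.sum_const, Finset.card_univ, Fintype.card_fin, nsmul_eq_mul] at h
        simpa [birkhoffSum] using h
      · obtain ⟨j, hj⟩ := Set.mem_iUnion.1 hi
        rw [𝒜.index_eq_iff.2 (hKsub j hj)]
        exact hgε j _ (Metric.mem_thickening_iff.2 ⟨y i, hj, by rw [dist_comm]; exact hd i⟩)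
  have hlim : Tendsto (fun n : ℕ => (n : ℝ) / (n + 1) * (c - I + ω) + ω) atTop
      (𝓝 (1 * (c - I + ω) + ω)) :=
    ((tendsto_natCast_div_add_atTop (1 : ℝ)).mul_const _).add_const _
  have hlimE := (EReal.tendsto_coe.2 hlim).limsup_eq
  refine (limsup_le_limsup (hbound.mono fun n hn => EReal.coe_le_coe_iff.2 hn)).trans ?_
  rw [hlimE]
  exact EReal.coe_le_coe_iff.2 (by linarith)

/-- The inequality `h_μ(Q) + ∫ φ dμQ ≤ P(T, φ)` for `Q`-invariant `μ`. -/
theorem kernelEntropy_le (hQ : T.Supports Q) (hμ : Q.Invariant μ) {φ : C(T.orbits 2, ℝ)}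
    {p : ℝ} (hp : T.pressure φ = p) :
    kernelEntropy Q μ ≤ ((p - T.doubleIntegral φ Q μ : ℝ) : EReal) := by
  refine iSup_le fun 𝒜 => EReal.le_of_forall_lt_iff_le.1 fun z hz => ?_
  -- One third goes to the excess of `c` over the pressure, two thirds to the error 2ω with ω = η.
  set η := (z - (p - T.doubleIntegral φ Q μ)) / 3
  have hη : 0 < η := by
    have : p - T.doubleIntegral φ Q μ < z := by exact_mod_cast hz
    exact div_pos (sub_pos.2 this) (by norm_num)
  have hc : T.pressure φ < ((p + η : ℝ) : EReal) := by
    rw [hp, EReal.coe_lt_coe_iff]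
    linarith
  refine (T.kernelEntropyOf_le hQ hμ φ hc hη 𝒜).trans (EReal.coe_le_coe_iff.2 (le_of_eq ?_))
  simp only [η]
  ring

/-! ### Tangency as minimality, and the abstract entropy -/

/-- A pair is a tangent functional to the pressure at `φ` if and only if `φ` minimizes
`P(T, ψ) - ∫ ψ dμQ` among all `ψ`. -/
theorem mem_tangentFunctionals_iff (hT : T.topEntropy < ⊤) (hQ : T.Supports Q)
    {φ : C(T.orbits 2, ℝ)} {p : ℝ} (hp : T.pressure φ = p) :
    (Q, μ) ∈ T.tangentFunctionals φ ↔ ∀ (ψ : C(T.orbits 2, ℝ)) (s : ℝ), T.pressure ψ = s →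
      p - T.doubleIntegral φ Q μ ≤ s - T.doubleIntegral ψ Q μ := by
  have : Nonempty X := nonempty_of_isProbabilityMeasure μ
  refine ⟨fun h ψ s hs => ?_, fun h => ⟨⟨inferInstance, hQ, inferInstance⟩, fun ψ => ?_⟩⟩
  · have h1 := h.2 (ψ + -φ)
    rw [add_add_neg_cancel'_right, hs, hp, T.orbitIntegral_eq_doubleIntegral hQ,
      T.doubleIntegral_add hQ, T.doubleIntegral_neg hQ, ← EReal.coe_sub, ge_iff_le,
      EReal.coe_le_coe_iff] at h1
    linarith
  · obtain ⟨s, hs⟩ := T.exists_pressure_eq_coe hT (φ + ψ)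
    have h1 := h _ s hs
    rw [T.doubleIntegral_add hQ] at h1
    rw [T.orbitIntegral_eq_doubleIntegral hQ, hs, hp, ← EReal.coe_sub, ge_iff_le,
      EReal.coe_le_coe_iff]
    linarith

/-- The function p − φ is an admissible competitor: subtracting the constant p = P(T,φ) from `φ`
brings its pressure down to at most 0. -/
theorem abstractEntropy_le (hQ : T.Supports Q) {φ : C(T.orbits 2, ℝ)} {p : ℝ}
    (hp : T.pressure φ = p) :
    T.abstractEntropy Q μ ≤ ((p - T.doubleIntegral φ Q μ : ℝ) : EReal) := by
  refine iInf₂_le_of_le (ContinuousMap.const _ p + -φ) ?_ ?_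
  · have h : T.pressure (-(ContinuousMap.const _ p + -φ)) ≤ T.pressure φ + ((-p : ℝ) : EReal) :=
      T.pressure_le_add fun x => by simp
    rw [hp, ← EReal.coe_add, add_neg_cancel] at h
    exact_mod_cast h
  · rw [T.doubleIntegral_add hQ, T.doubleIntegral_const hQ, T.doubleIntegral_neg hQ,
      ← sub_eq_add_neg]

end Correspondence

/-- A real left-hand side excludes infinite `h`, so the equilibrium equation can be solved for the
entropy. -/
theorem EReal.eq_sub_of_coe_eq_add_coe {p d : ℝ} {h : EReal} (H : (p : EReal) = h + d) :
    h = ((p - d : ℝ) : EReal) := by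
  induction h with
  | coe h =>
    rw [← EReal.coe_add, EReal.coe_eq_coe_iff] at H
    exact EReal.coe_eq_coe_iff.2 (by linarith)
  | bot => simp at H
  | top => simp at H

theorem mainTheorem4 {X : Type*} [MetricSpace X] [CompactSpace X] [MeasurableSpace X]
    [BorelSpace X] (T : Correspondence X) (hT : T.topEntropy < ⊤) (φ : C(T.orbits 2, ℝ)) :
    T.typeIEquilibriumStates φ ⊆ T.tangentFunctionals φ ∧
      T.typeIIEquilibriumStates φ = T.tangentFunctionals φ := by
  refine ⟨?_, Set.Subset.antisymm ?_ ?_⟩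
  · rintro ⟨Q, μ⟩ ⟨⟨hMk, hQ, hPr⟩, hμ, hP⟩
    dsimp only at hMk hQ hPr hμ hP
    -- The probability measure rules out the empty space, where the pressure would not be real.
    have : Nonempty X := nonempty_of_isProbabilityMeasure μ
    obtain ⟨p, hp⟩ := T.exists_pressure_eq_coe hT φ
    rw [hp] at hP
    refine (T.mem_tangentFunctionals_iff hT hQ hp).2 fun ψ s hs => ?_
    have h := T.kernelEntropy_le hQ hμ hs
    rw [EReal.eq_sub_of_coe_eq_add_coe hP] at h
    exact_mod_cast h
  · rintro ⟨Q, μ⟩ ⟨⟨hMk, hQ, hPr⟩, hP⟩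
    dsimp only at hMk hQ hPr hP
    have : Nonempty X := nonempty_of_isProbabilityMeasure μ
    obtain ⟨p, hp⟩ := T.exists_pressure_eq_coe hT φ
    rw [hp] at hP
    refine (T.mem_tangentFunctionals_iff hT hQ hp).2 fun ψ s hs => ?_
    have h := T.abstractEntropy_le (μ := μ) hQ hs
    rw [EReal.eq_sub_of_coe_eq_add_coe hP] at h
    exact_mod_cast h
  · rintro ⟨Q, μ⟩ h
    obtain ⟨hMk, hQ, hPr⟩ := h.1
    dsimp only at hMk hQ hPr
    have : Nonempty X := nonempty_of_isProbabilityMeasure μ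
    obtain ⟨p, hp⟩ := T.exists_pressure_eq_coe hT φ
    have hmin := (T.mem_tangentFunctionals_iff hT hQ hp).1 h
    have heq : T.abstractEntropy Q μ = ((p - T.doubleIntegral φ Q μ : ℝ) : EReal) := by
      refine le_antisymm (T.abstractEntropy_le hQ hp) (le_iInf₂ fun ψ hψ => ?_)
      obtain ⟨s, hs⟩ := T.exists_pressure_eq_coe hT (-ψ)
      -- Minimality tested on −ψ, whose pressure `s` is at most 0, gives p − ∫φ ≤ s + ∫ψ ≤ ∫ψ.
      have h1 := hmin _ s hs
      rw [hs] at hψ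
      have h2 : s ≤ 0 := by exact_mod_cast hψ
      rw [T.doubleIntegral_neg hQ] at h1
      exact EReal.coe_le_coe_iff.2 (by linarith)
    refine ⟨h.1, ?_⟩
    dsimp only
    rw [hp, heq, ← EReal.coe_add, sub_add_cancel]
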